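/- Let $T$ be a finite or countable set. A simple multitype branching process with type set $T$, root distribution $\dot\mu$ (a probability distribution on $T$) and offspring distributions $\mu^{k\to j}$ ($k,j\in T$, probability distributions on $\mathbb N=\{0,1,2,\dots\}$) is the random rooted tree $(U,\rho)$ in which the root $\rho$ has a random type with law $\dot\mu$, and each node of type $k$ has, for every $j\in T$, exactly $\xi^{j}\sim\mu^{k\to j}$ children of type $j$, the numbers $\xi^j$ being independent for distinct $j$ and for distinct nodes, and independent of the type of the root (the types being assigned to the enumerated children uniformly at random). It is assumed that the total number of children of a node, $\sum_j\xi^j$, is almost surely finite, for every type $k$ of the node. Give the nodes of $U$ independent labels $\sigma_v$, uniform on $[0,1]$ and independent of $U$. The past $\mathcal P_\rho$ of the root is the set of nodes reachable from $\rho$ by a path with decreasing labels. Assume that $(U,\rho)$ has nonexplosive growth, that is, $\mathcal P_\rho$ is almost surely finite, and let $\iota(U,\rho)=\Pr[\rho\in\mathbf I(U[\mathcal P_\rho])]$, where $\mathbf I(G)$ is the greedy maximal independent set of the finite labelled graph $G$: a vertex belongs to $\mathbf I(G)$ if and only if none of its neighbours with a smaller label does. For $x\in[0,1]$ let $\mu^{k\to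 j}_x=\mathsf{Bin}(\mu^{k\to j},x)$, that is, $\mu^{k\to j}_x(\ell)=\sum_{n\ge \ell}\mu^{k\to j}(n)\binom n\ell x^\ell(1-x)^{n-\ell}$. The fundamental system of ODEs of $(U,\rho)$ is $$y_k'(x)=\sum_{\ell\in\mathbb N^T}\ \prod_{j\in T}\mu^{k\to j}_x(\ell_j)\left(1-\frac{y_j(x)}{x}\right)^{\ell_j},\qquad y_k(0)=0\qquad(k\in T,\ x\in[0,1]),$$ with one-sided derivatives at $x=0$ and $x=1$; at $x=0$ the right-hand side is read as $1$, since only $\ell=0$ contributes. Then there is a solution $(y_k)_{k\in T}$ of the fundamental system with $0\le y_k(x)\le x$ for all $k\in T$ and $x\in[0,1]$, such that $$\iota(U,\rho)=\sum_{k\in T}y_k(1)\,\dot\mu(k),$$ and this formula holds for every solution of the fundamental system that satisfies $0\le y_k(x)\le x$ for all $k\in T$ and $x\in[0,1]$. -/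

import Mathlib

open MeasureTheory Set

noncomputable section

/-! ### Labelled graphs: the past of a vertex and the greedy maximal independent set -/

namespace SimpleGraph

/-- The past of `v`: the vertices that can be reached from `v` along a path of `G` on which the
labels `σ` decrease. -/
def past {V : Type*} (G : SimpleGraph V) (σ : V → unitInterval) (v : V) : Set V :=
  {u | Relation.ReflTransGen (fun a b => G.Adj a b ∧ σ b < σ a) v u}

theorem self_mem_past {V : Type*} (G : SimpleGraph V) (σ : V → unitInterval) (v : V) :
    v ∈ G.past σ v :=
  Relation.ReflTransGen.refl

theorem wellFounded_label {V : Type*} [Finite V] (σ : V → unitInterval) :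
    WellFounded (fun u v : V => σ u < σ v) := by
  have : IsTrans V (fun u v : V => σ u < σ v) := ⟨fun _ _ _ h h' => h.trans h'⟩
  have : Std.Irrefl (fun u v : V => σ u < σ v) := ⟨fun _ => lt_irrefl _⟩
  exact Finite.wellFounded_of_trans_of_irrefl _

/-- The greedy maximal independent set of a finite graph with arrival times `σ`: at the time given
by its label, a vertex becomes occupied if and only if all its neighbours are still vacant, that is,
if and only if no neighbour with a smaller label is occupied. -/
def greedyMIS {V : Type*} [Finite V] (G : SimpleGraph V) (σ : V → unitInterval) : Set V :=
  {v | (wellFounded_label σ).fix (C := fun _ => Prop)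
    (fun v occupied => ∀ (u : V) (h : σ u < σ v), G.Adj v u → ¬ occupied u h) v}

theorem mem_greedyMIS {V : Type*} [Finite V] (G : SimpleGraph V) (σ : V → unitInterval) (v : V) :
    v ∈ G.greedyMIS σ ↔ ∀ u, σ u < σ v → G.Adj v u → u ∉ G.greedyMIS σ := by
  unfold greedyMIS
  rw [mem_ofPred_eq, WellFounded.fix_eq]
  rfl

/-- The past of `v` is finite, and `v` belongs to the greedy maximal independent set of the subgraph
of `G` induced by it. -/
def GreedyOccupied {V : Type*} (G : SimpleGraph V) (σ : V → unitInterval) (v : V) : Prop :=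
  ∃ h : (G.past σ v).Finite,
    haveI : Finite (G.past σ v) := h.to_subtype
    (⟨v, G.self_mem_past σ v⟩ : G.past σ v) ∈
      (G.induce (G.past σ v)).greedyMIS (fun u => σ u)

end SimpleGraph

/-! ### Simple multitype branching processes -/

/-- The data of a simple multitype branching process with type set `T`. The numbers `ξ j` of children
of type `j` of a node of type `k` are independent for distinct `j`, with `ξ j ∼ offspring k j`; the
total number of children of a node is almost surely finite. -/
structure SimpleBranchingProcess (T : Type*) where
  /-- The distribution of the type of the root. -/
  root : PMF T
  /-- The distribution of the number of children of type `j` of a node of type `k`. -/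
  offspring : T → T → PMF ℕ
  finite_offspring : ∀ k, ∀ᵐ ξ ∂(Measure.infinitePi fun j => (offspring k j).toMeasure),
    (Function.support ξ).Finite

instance List.discreteMeasurableSpace {T : Type*} : MeasurableSpace (List T) := ⊤

namespace SimpleBranchingProcess

variable {T : Type*}

/-- The law of the offspring vector of a node of type `k`, a product measure. -/
def offspringLaw (B : SimpleBranchingProcess T) (k : T) : Measure (T → ℕ) :=
  Measure.infinitePi fun j => (B.offspring k j).toMeasure

open Classical in
theorem tsum_offspringLaw [Countable T] (B : SimpleBranchingProcess T) (k : T) :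
    ∑' s : Multiset T, B.offspringLaw k {fun j => s.count j} = 1 := by
  have : IsProbabilityMeasure (B.offspringLaw k) := by
    unfold offspringLaw; infer_instance
  have : Countable (Multiset T) := by
    unfold Multiset; infer_instance
  rw [← measure_iUnion]
  · rw [← prob_compl_eq_zero_iff₀]
    · refine measure_mono_null ?_ (B.finite_offspring k)
      intro ξ hξ hfin
      apply hξ
      rw [mem_iUnion]
      refine ⟨Finsupp.toMultiset (Finsupp.ofSupportFinite ξ hfin), ?_⟩
      rw [mem_singleton_iff]
      funext j
      rw [Finsupp.count_toMultiset]
      rfl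
    · exact (MeasurableSet.iUnion fun s => measurableSet_singleton _).nullMeasurableSet
  · intro s t hst
    rw [Function.onFun, disjoint_singleton]
    intro h
    exact hst (Multiset.ext.2 fun j => congrFun h j)
  · exact fun s => measurableSet_singleton _

open Classical in
/-- The law of the multiset of the types of the children of a node of type `k`. -/
def childMultisetLaw [Countable T] (B : SimpleBranchingProcess T) (k : T) : PMF (Multiset T) :=
  ⟨fun s => B.offspringLaw k {fun j => s.count j}, by
    rw [← B.tsum_offspringLaw k]; exact ENNReal.summable.hasSum⟩

theorem lists_nonempty [DecidableEq T] (s : Multiset T) : s.lists.toFinset.Nonempty := by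
  induction s using Quotient.inductionOn with
  | h l => exact ⟨l, Multiset.mem_toFinset.2 ((Multiset.mem_lists_iff _ _).2 rfl)⟩

open Classical in
/-- The law of the list of the types of the children `0, 1, …` of a node of type `k`: given the
multiset of the types, the list is uniform among its distinct orderings. -/
def childrenLaw [Countable T] (B : SimpleBranchingProcess T) (k : T) : PMF (List T) :=
  (B.childMultisetLaw k).bind fun s => PMF.uniformOfFinset s.lists.toFinset (lists_nonempty s)

/-- The sample space. Nodes are finite sequences of natural numbers, with the last element first:
`i :: v` is the child number `i` of `v`. -/
structure Sample (T : Type*) where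
  /-- The type of the root. -/
  rootType : T
  /-- `children (v, k)` lists the types of the children of `v`, in case `v` has type `k`. -/
  children : List ℕ × T → List T
  /-- The labels (arrival times). -/
  label : List ℕ → unitInterval

namespace Sample

/-- The sample space as a product. -/
def ofProd (p : T × (List ℕ × T → List T) × (List ℕ → unitInterval)) : Sample T :=
  ⟨p.1, p.2.1, p.2.2⟩

instance [MeasurableSpace T] : MeasurableSpace (Sample T) :=
  MeasurableSpace.map ofProd inferInstance

/-- The type of the node `v`, if `v` belongs to the tree. -/
def nodeType (ω : Sample T) : List ℕ → Option T
  | [] => some ω.rootType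
  | i :: v => (ω.nodeType v).bind fun k => (ω.children (v, k))[i]?

/-- The vertices of the tree. -/
def vertices (ω : Sample T) : Set (List ℕ) :=
  {v | (ω.nodeType v).isSome}

/-- The tree `U`: every vertex other than the root is joined to its parent. -/
def tree (ω : Sample T) : SimpleGraph ω.vertices :=
  SimpleGraph.fromRel fun u v => ∃ i : ℕ, (v : List ℕ) = i :: (u : List ℕ)

/-- The root `ρ` of the tree. -/
def root (ω : Sample T) : ω.vertices :=
  ⟨[], rfl⟩

/-- The labelling of the vertices of the tree. -/
def treeLabel (ω : Sample T) : ω.vertices → unitInterval :=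
  fun v => ω.label v

end Sample

section

variable [Countable T] [MeasurableSpace T]

/-- The probability measure: the type of the root, the offspring of the nodes and the labels are all
independent, and the labels are uniform on `[0, 1]`. -/
def law (B : SimpleBranchingProcess T) : Measure (Sample T) :=
  (B.root.toMeasure.prod
    ((Measure.infinitePi fun vk : List ℕ × T => (B.childrenLaw vk.2).toMeasure).prod
      (Measure.infinitePi fun _ : List ℕ => (volume : Measure unitInterval)))).map Sample.ofProd

/-- Nonexplosive growth: the past of the root is almost surely finite. -/
def NonexplosiveGrowth (B : SimpleBranchingProcess T) : Prop :=
  ∀ᵐ ω ∂B.law, (ω.tree.past ω.treeLabel ω.root).Finite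

/-- `ι(U, ρ)`: the probability that the root belongs to the greedy maximal independent set of the
subgraph induced by its past. -/
def iota (B : SimpleBranchingProcess T) : ℝ :=
  B.law.real {ω | ω.tree.GreedyOccupied ω.treeLabel ω.root}

end

/-- The mass at `ℓ` of `Bin(μ, x)`, the law of a binomial variable with `N` trials and success
probability `x`, where `N ∼ μ`. -/
def binMass (μ : PMF ℕ) (x : ℝ) (ℓ : ℕ) : ℝ :=
  ∑' n : ℕ, (μ n).toReal * (n.choose ℓ * x ^ ℓ * (1 - x) ^ (n - ℓ))

/-- The right hand side of the equation for `y k` in the fundamental system, at time `x` and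
with `y j x = z j`. -/
def fundamentalField (B : SimpleBranchingProcess T) (k : T) (x : ℝ) (z : T → ℝ) : ℝ :=
  ∑' ℓ : T → ℕ, ∏' j, binMass (B.offspring k j) x (ℓ j) * (1 - z j / x) ^ ℓ j

/-- The family `y` solves the fundamental system of ODEs on `[0, 1]` (with one-sided derivatives at
the endpoints). -/
def IsFundamentalSolution (B : SimpleBranchingProcess T) (y : T → ℝ → ℝ) : Prop :=
  ∀ k, y k 0 = 0 ∧ ∀ x ∈ Icc (0 : ℝ) 1,
    HasDerivWithinAt (y k) (B.fundamentalField k x fun j => y j x) (Icc 0 1) x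

end SimpleBranchingProcess

end

open Filter Topology ProbabilityTheory
open scoped unitInterval ENNReal

/-!
Conditionally on its label being `s`, the root is occupied exactly when all its children are vacant
at time `s`, and the subtrees of the children are independent copies of the process. Hence the
probabilities `y k x` that a root of type `k` is occupied before time `x` satisfy the integral
equation `y k x = ∫ s in 0..x, F (y s) k`, where `F z k` is the probability that a node of type `k`
has no occupied child when each child of type `j` is occupied with probability `z j`. Expanding
`1 - z j = 1 - x + x (1 - z j / x)` by the binomial formula identifies `F` with the right hand side
of the fundamental system.

Nothing makes `F` Lipschitz, so solutions come from compactness (a delayed equation and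
Arzelà–Ascoli). Their values at `1`, averaged over the type of the root, are nevertheless forced:
exploring the tree up to depth `n` turns the recursion into the `n`-th Picard iterate `u n` of `0`,
and since `F` is antitone, `u (2 n) ≤ y ≤ u (2 n + 1)` for every solution `y`. If the past of the
root is finite, the explored tree eventually decides the root correctly, so that both averaged
bounds converge to `ι` at time `1`.
-/

/-! ### Picard's operator for a continuous autonomous field on the cube -/

section PicardOperator

theorem integral_coe_mem_Icc {α : Type*} [MeasurableSpace α] (μ : Measure α) [IsFiniteMeasure μ]
    (f : α → I) : ∫ a, (f a : ℝ) ∂μ ∈ Icc 0 (μ.real univ) := by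
  refine ⟨integral_nonneg fun a => (f a).2.1, (le_abs_self _).trans ?_⟩
  simpa using norm_integral_le_of_norm_le_const (μ := μ) (f := fun a => (f a : ℝ)) (C := 1)
    (ae_of_all _ fun a => by simpa only [Real.norm_eq_abs, abs_of_nonneg (f a).2.1] using (f a).2.2)

theorem integrable_coe_unitInterval {α : Type*} [MeasurableSpace α] {μ : Measure α}
    [IsFiniteMeasure μ] {f : α → I} (hf : Measurable f) : Integrable (fun a => (f a : ℝ)) μ :=
  .of_bound hf.subtype_val.aestronglyMeasurable 1
    (ae_of_all _ fun a => by simpa only [Real.norm_eq_abs, abs_of_nonneg (f a).2.1] using (f a).2.2)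

theorem setIntegral_Iio_coe_mem_Icc (g : I → I) (x : I) :
    ∫ s in Iio x, (g s : ℝ) ∈ Icc 0 (x : ℝ) := by
  simpa [measureReal_def, ENNReal.toReal_ofReal x.2.1] using
    integral_coe_mem_Icc (volume.restrict (Iio x)) g

theorem dist_setIntegral_Iio_le {g : I → I} (hg : Measurable g) (x x' : I) :
    dist (∫ s in Iio x, (g s : ℝ)) (∫ s in Iio x', (g s : ℝ)) ≤ dist x x' := by
  wlog h : x' ≤ x generalizing x x'
  · rw [dist_comm, dist_comm x]
    exact this x' x (le_of_not_ge h)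
  have hint (s : Set I) : IntegrableOn (fun s => (g s : ℝ)) s := integrable_coe_unitInterval hg
  have hsplit : ∫ s in Iio x, (g s : ℝ) =
      (∫ s in Iio x', (g s : ℝ)) + ∫ s in Ico x' x, (g s : ℝ) := by
    have hdisj : Disjoint (Iio x') (Ico x' x) :=
      (Iio_disjoint_Ici le_rfl).mono_right Ico_subset_Ici_self
    rw [← Iio_union_Ico_eq_Iio h, setIntegral_union hdisj measurableSet_Ico (hint _) (hint _)]
  have hx : (0 : ℝ) ≤ x - x' := sub_nonneg.2 h
  have hmem : ∫ s in Ico x' x, (g s : ℝ) ∈ Icc 0 (x - x' : ℝ) := by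
    simpa [measureReal_def, ENNReal.toReal_ofReal hx] using
      integral_coe_mem_Icc (volume.restrict (Ico x' x)) g
  rw [hsplit, Real.dist_eq, add_sub_cancel_left, abs_of_nonneg hmem.1, Subtype.dist_eq,
    Real.dist_eq, abs_of_nonneg hx]
  exact hmem.2

variable {ι : Type*}

/-- The Picard operator of the autonomous system `y' = F y`, `y 0 = 0`, on `[0, 1]`. -/
noncomputable def picard (F : C(ι → I, ι → I)) (y : C(I, ι → I)) : C(I, ι → I) where
  toFun x k := ⟨∫ s in Iio x, (F (y s) k : ℝ),
    Icc_subset_Icc_right x.2.2 (setIntegral_Iio_coe_mem_Icc _ x)⟩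
  continuous_toFun := continuous_pi fun k =>
    have hg : Continuous fun s => F (y s) k := by fun_prop
    (LipschitzWith.of_dist_le_mul (K := 1) fun x x' => by
      rw [NNReal.coe_one, one_mul]
      exact dist_setIntegral_Iio_le hg.measurable x x').continuous

variable {F : C(ι → I, ι → I)} {y z : C(I, ι → I)}

theorem coe_picard (x : I) (k : ι) : (picard F y x k : ℝ) = ∫ s in Iio x, (F (y s) k : ℝ) :=
  rfl

theorem picard_apply_le (x : I) (k : ι) : picard F y x k ≤ x :=
  (setIntegral_Iio_coe_mem_Icc (fun s => F (y s) k) x).2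

theorem dist_picard_le (x x' : I) (k : ι) : dist (picard F y x k) (picard F y x' k) ≤ dist x x' :=
  have hg : Continuous fun s => F (y s) k := by fun_prop
  dist_setIntegral_Iio_le hg.measurable x x'

theorem picard_congr {t x : I} (h : ∀ s < t, y s = z s) (hx : x ≤ t) :
    picard F y x = picard F z x := by
  ext k
  rw [coe_picard, coe_picard]
  exact setIntegral_congr_fun measurableSet_Iio fun s hs => by
    simp only [h s ((mem_Iio.1 hs).trans_le hx)]

theorem picard_antitone (hF : Antitone F) : Antitone (picard F) := fun y z h x k =>
  have hint (y : C(I, ι → I)) : IntegrableOn (fun s => (F (y s) k : ℝ)) (Iio x) :=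
    have hg : Continuous fun s => F (y s) k := by fun_prop
    integrable_coe_unitInterval hg.measurable
  setIntegral_mono (hint z) (hint y) fun s => hF (h s) k

theorem continuous_picard_apply (x : I) (k : ι) : Continuous fun y => picard F y x k := by
  have hint : Continuous fun g : C(I, I) => ∫ s in Iio x, (g s : ℝ) :=
    continuous_of_dominated (bound := fun _ => 1)
      (fun g => (integrable_coe_unitInterval g.continuous.measurable).aestronglyMeasurable)
      (fun g => ae_of_all _ fun s => by
        simpa only [Real.norm_eq_abs, abs_of_nonneg (g s).2.1] using (g s).2.2)
      (integrable_const 1) (ae_of_all _ fun s => by fun_prop)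
  let Fk : C(ι → I, I) := ⟨fun u => F u k, by fun_prop⟩
  exact .subtype_mk (hint.comp Fk.continuous_postcomp) _

theorem iterate_picard_bounds (hF : Antitone F) (hy : Function.IsFixedPt (picard F) y) (n : ℕ) :
    (picard F)^[2 * n] 0 ≤ y ∧ y ≤ (picard F)^[2 * n + 1] 0 := by
  have upper {u : C(I, ι → I)} (h : u ≤ y) : y ≤ picard F u :=
    hy.symm.le.trans (picard_antitone hF h)
  have lower {u : C(I, ι → I)} (h : y ≤ u) : picard F u ≤ y := (picard_antitone hF h).trans hy.le
  have heven : (picard F)^[2 * n] 0 ≤ y := by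
    induction n with
    | zero => exact fun x k => (y x k).2.1
    | succ n ih =>
      rw [mul_add, mul_one, Function.iterate_succ_apply', Function.iterate_succ_apply']
      exact lower (upper ih)
  exact ⟨heven, by rw [Function.iterate_succ_apply']; exact upper heven⟩

/-- Translation by `-ε`, truncated at `0`. -/
noncomputable def delay (ε : ℝ) : C(I, I) where
  toFun x := projIcc 0 1 zero_le_one (x - ε)

theorem lt_sub_of_lt_delay {ε : ℝ} {s x : I} (h : s < delay ε x) : (s : ℝ) < x - ε := by
  have h' : (s : ℝ) < max 0 (min 1 (x - ε)) := coe_projIcc (0 : ℝ) 1 zero_le_one (x - ε) ▸ h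
  exact (lt_min_iff.1 ((lt_max_iff.1 h').resolve_left s.2.1.not_gt)).2

theorem exists_picard_comp_delay_eq (F : C(ι → I, ι → I)) {ε : ℝ} (hε : 0 < ε) :
    ∃ y : C(I, ι → I), (picard F y).comp (delay ε) = y := by
  -- `Φ y` at `x` depends only on `y` before `x - ε`, so its iterates stabilise on `[0, n ε)`.
  let Φ : C(I, ι → I) → C(I, ι → I) := fun y => (picard F y).comp (delay ε)
  have agree (n : ℕ) : ∀ x : I, (x : ℝ) < n * ε → Φ^[n] 0 x = Φ^[n + 1] 0 x := by
    induction n with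
    | zero => exact fun x hx => absurd x.2.1 (by simpa using hx)
    | succ n ih =>
      intro x hx
      rw [Function.iterate_succ_apply', Function.iterate_succ_apply' Φ (n + 1)]
      refine picard_congr (t := delay ε x) (fun s hs => ih s ?_) le_rfl
      have hs' : (s : ℝ) < x - ε := lt_sub_of_lt_delay hs
      push_cast at hx
      linarith
  obtain ⟨n, hn⟩ := exists_nat_gt ε⁻¹
  refine ⟨Φ^[n] 0, ContinuousMap.ext fun x => ?_⟩
  rw [agree n x, Function.iterate_succ_apply']
  exact x.2.2.trans_lt ((inv_lt_iff_one_lt_mul₀ hε).1 hn)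

theorem dist_delay_delay_le (ε : ℝ) (x x' : I) : dist (delay ε x) (delay ε x') ≤ dist x x' := by
  simpa [delay, Subtype.dist_eq, Real.dist_eq] using
    abs_projIcc_sub_projIcc zero_le_one (c := (x : ℝ) - ε) (d := x' - ε)

theorem dist_delay_le {ε : ℝ} (hε : 0 ≤ ε) (x : I) : dist (delay ε x) x ≤ ε := by
  nth_rw 2 [← projIcc_val zero_le_one x]
  simpa [delay, Subtype.dist_eq, Real.dist_eq, abs_of_nonneg hε] using
    abs_projIcc_sub_projIcc zero_le_one (c := (x : ℝ) - ε) (d := x)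

theorem equicontinuous_pi {X α β : Type*} [TopologicalSpace X] [UniformSpace β] {f : α → X → ι → β}
    (h : ∀ k, Equicontinuous fun a x => f a x k) : Equicontinuous f := by
  rw [Pi.uniformSpace_eq, equicontinuous_iInf_rng]
  intro k
  let : UniformSpace (ι → β) := .comap (Function.eval k) ‹UniformSpace β›
  have heval : IsUniformInducing (Function.eval k : (ι → β) → β) := .mk rfl
  exact heval.equicontinuous_iff.2 (h k)

theorem isCompact_setOf_dist_le :
    IsCompact {y : C(I, ι → I) | ∀ x x' k, dist (y x k) (y x' k) ≤ dist x x'} := by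
  refine ArzelaAscoli.isCompact_of_equicontinuous _ ?_ ?_
  · have himage : ContinuousMap.toFun ''
        {y : C(I, ι → I) | ∀ x x' k, dist (y x k) (y x' k) ≤ dist x x'} =
        {y : I → ι → I | ∀ x x' k, dist (y x k) (y x' k) ≤ dist x x'} := by
      refine Subset.antisymm (image_subset_iff.2 fun y hy => hy) fun y hy => ?_
      exact ⟨⟨y, continuous_pi fun k => (LipschitzWith.of_dist_le_mul (K := 1) fun x x' => by
        simpa using hy x x' k).continuous⟩, hy, rfl⟩
    rw [himage]
    refine IsClosed.isCompact ?_
    simp only [ofPred_forall]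
    exact isClosed_iInter fun x => isClosed_iInter fun x' => isClosed_iInter fun k =>
      isClosed_le (by fun_prop) continuous_const
  · exact equicontinuous_pi fun k => Metric.equicontinuous_of_continuity_modulus id tendsto_id _
      fun x x' y => y.2 x x' k

theorem exists_isFixedPt_picard (F : C(ι → I, ι → I)) :
    ∃ y, Function.IsFixedPt (picard F) y := by
  let almostFixed (n : ℕ) : Set C(I, ι → I) :=
    {y | (∀ x x' k, dist (y x k) (y x' k) ≤ dist x x') ∧
      ∀ x k, dist (picard F y x k) (y x k) ≤ 1 / (n + 1)}
  have hclosed (n : ℕ) : IsClosed (almostFixed n) := by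
    simp only [almostFixed, ofPred_and, ofPred_forall]
    refine .inter ?_ ?_
    · exact isClosed_iInter fun x => isClosed_iInter fun x' => isClosed_iInter fun k =>
        isClosed_le (by fun_prop) continuous_const
    · exact isClosed_iInter fun x => isClosed_iInter fun k =>
        isClosed_le ((continuous_picard_apply x k).dist (by fun_prop)) continuous_const
  have hnonempty (n : ℕ) : (almostFixed n).Nonempty := by
    obtain ⟨y, hy⟩ := exists_picard_comp_delay_eq F (ε := 1 / (n + 1)) (by positivity)
    have hval (x : I) : y x = picard F y (delay (1 / (n + 1)) x) := (DFunLike.congr_fun hy x).symm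
    refine ⟨y, fun x x' k => ?_, fun x k => ?_⟩
    · rw [hval x, hval x']
      exact (dist_picard_le _ _ k).trans (dist_delay_delay_le _ x x')
    · rw [hval x, dist_comm]
      exact (dist_picard_le _ _ k).trans (dist_delay_le (by positivity) x)
  have hsucc (n : ℕ) : almostFixed (n + 1) ⊆ almostFixed n := fun y hy =>
    ⟨hy.1, fun x k => (hy.2 x k).trans (Nat.one_div_le_one_div n.le_succ)⟩
  obtain ⟨y, hy⟩ := IsCompact.nonempty_iInter_of_sequence_nonempty_isCompact_isClosed almostFixed
    hsucc hnonempty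
    (isCompact_setOf_dist_le.of_isClosed_subset (hclosed 0) fun y hy => hy.1) hclosed
  refine ⟨y, ContinuousMap.ext fun x => funext fun k => dist_le_zero.1 ?_⟩
  exact ge_of_tendsto' tendsto_one_div_add_atTop_nhds_zero_nat fun n => (mem_iInter.1 hy n).2 x k

theorem setIntegral_Iio_eq_intervalIntegral {E : Type*} [NormedAddCommGroup E] [NormedSpace ℝ E]
    (g : I → E) (x : I) :
    ∫ s in Iio x, g s = ∫ s in (0 : ℝ)..x, IccExtend zero_le_one g s := by
  have hIco : Iio (x : ℝ) ∩ I = Ico 0 (x : ℝ) := by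
    ext s; exact ⟨fun h => ⟨h.2.1, h.1⟩, fun h => ⟨h.2, h.1, h.2.le.trans x.2.2⟩⟩
  rw [intervalIntegral.integral_of_le x.2.1, ← integral_Ico_eq_integral_Ioc, ← hIco,
    ← Measure.restrict_restrict measurableSet_Iio,
    ← unitInterval.measurePreserving_coe.setIntegral_preimage_emb
      unitInterval.measurableEmbedding_coe]
  exact setIntegral_congr_fun measurableSet_Iio fun s _ => (IccExtend_val _ g s).symm

theorem isFixedPt_picard_iff : Function.IsFixedPt (picard F) y ↔
    ∀ k, y 0 k = 0 ∧ ∀ x : I,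
      HasDerivWithinAt (fun t => (y (projIcc 0 1 zero_le_one t) k : ℝ)) (F (y x) k) I x := by
  let velocity (k : ι) : ℝ → ℝ := IccExtend zero_le_one fun s : I => (F (y s) k : ℝ)
  have hvelocity (k : ι) : Continuous (velocity k) :=
    Continuous.Icc_extend' (by fun_prop)
  have hpicard (x : I) (k : ι) : (picard F y x k : ℝ) = ∫ s in (0 : ℝ)..x, velocity k s :=
    setIntegral_Iio_eq_intervalIntegral _ x
  have hval (x : I) (k : ι) : velocity k x = F (y x) k := IccExtend_val _ _ x
  constructor
  · refine fun hy k => ⟨?_, fun x => ?_⟩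
    · rw [← hy]; ext; simp [hpicard]
    · rw [← hval]
      refine ((hvelocity k).integral_hasStrictDerivAt 0 x).hasDerivAt.hasDerivWithinAt.congr_of_mem
        (fun t ht => ?_) x.2
      rw [projIcc_of_mem _ ht, ← hpicard ⟨t, ht⟩, hy]
  · refine fun h => ContinuousMap.ext fun x => funext fun k => Subtype.ext ?_
    have hderiv (t : ℝ) (ht : t ∈ Ioo 0 (x : ℝ)) :
        HasDerivWithinAt (fun t => (y (projIcc 0 1 zero_le_one t) k : ℝ)) (velocity k t)
          (Ioi t) t := by
      have ht1 : t < 1 := ht.2.trans_le x.2.2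
      rw [show velocity k t = F (y ⟨t, ht.1.le, ht1.le⟩) k from hval ⟨t, _⟩ k]
      exact ((h k).2 _).mono_of_mem_nhdsWithin (Icc_mem_nhdsGT_of_mem ⟨ht.1.le, ht1⟩)
    rw [hpicard, intervalIntegral.integral_eq_sub_of_hasDeriv_right_of_le x.2.1 (by fun_prop)
      hderiv ((hvelocity k).intervalIntegrable _ _), projIcc_val, projIcc_left]
    simp [(h k).1]

end PicardOperator

/-! ### Independent thinning and infinite products -/

section InfiniteProduct

variable {T : Type*}

theorem hasProd_of_le_one {f : T → ℝ≥0∞} (hf : ∀ j, f j ≤ 1) : HasProd f (∏' j, f j) := by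
  rw [ENNReal.tprod_eq_iInf_prod hf]
  exact ENNReal.hasProd_iInf_prod hf

theorem tprod_ne_top_of_le_one {f : T → ℝ≥0∞} (hf : ∀ j, f j ≤ 1) : ∏' j, f j ≠ ∞ := by
  rw [ENNReal.tprod_eq_iInf_prod hf]
  exact ne_top_of_le_ne_top ENNReal.one_ne_top (iInf_le_of_le ∅ Finset.prod_empty.le)

theorem toReal_tprod_of_le_one {f : T → ℝ≥0∞} (hf : ∀ j, f j ≤ 1) :
    (∏' j, f j).toReal = ∏' j, (f j).toReal := by
  have hprod : HasProd (fun j => (f j).toReal) (∏' j, f j).toReal :=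
    ((ENNReal.tendsto_toReal (tprod_ne_top_of_le_one hf)).comp (hasProd_of_le_one hf)).congr
      fun s => ENNReal.toReal_prod s f
  exact hprod.tprod_eq.symm

theorem toReal_tsum_tprod_of_le_one {ι : Type*} {f : ι → T → ℝ≥0∞} (hf : ∀ i j, f i j ≤ 1) :
    (∑' i, ∏' j, f i j).toReal = ∑' i, ∏' j, (f i j).toReal := by
  rw [ENNReal.tsum_toReal_eq fun i => tprod_ne_top_of_le_one (hf i)]
  exact tsum_congr fun i => toReal_tprod_of_le_one (hf i)

theorem tsum_pi_tprod_eq_prod_sum (J : Finset T) (N : T → ℕ) {g : T → ℕ → ℝ≥0∞}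
    (hJ : ∀ j ∉ J, g j 0 = 1) (hN : ∀ j m, N j < m → g j m = 0) (hNJ : ∀ j ∉ J, N j = 0) :
    ∑' ℓ : T → ℕ, ∏' j, g j (ℓ j) = ∏ j ∈ J, ∑ m ∈ Finset.range (N j + 1), g j m := by
  classical
  let extend (q : J → ℕ) : T → ℕ := fun j => if hj : j ∈ J then q ⟨j, hj⟩ else 0
  have extend_coe (q : J → ℕ) (j : J) : extend q (j : T) = q j := dif_pos j.2
  have extend_injective : Function.Injective extend := fun q q' h => funext fun j => by
    rw [← extend_coe q, h, extend_coe]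
  have tprod_extend (q : J → ℕ) : ∏' j : T, g j (extend q j) = ∏ j : J, g j (q j) := by
    rw [tprod_eq_prod (s := J) fun j hj => by rw [show extend q j = 0 from dif_neg hj, hJ j hj],
      ← Finset.prod_coe_sort]
    exact Finset.prod_congr rfl fun j _ => by rw [extend_coe]
  rw [← extend_injective.tsum_eq, ← Finset.prod_coe_sort, Finset.prod_univ_sum]
  · simp only [tprod_extend]
    refine tsum_eq_sum fun q hq => ?_
    obtain ⟨j, hj⟩ : ∃ j : J, N j < q j := by simpa [Fintype.mem_piFinset, Nat.lt_succ_iff] using hq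
    exact Finset.prod_eq_zero (Finset.mem_univ j) (hN j _ hj)
  · refine fun ℓ hℓ => ⟨fun j : J => ℓ j, funext fun j => ?_⟩
    by_cases hj : j ∈ J
    · exact extend_coe (fun j : J => ℓ j) ⟨j, hj⟩
    · refine (dif_neg hj).trans (by_contra fun h0 => hℓ (tprod_of_exists_eq_zero ⟨j, ?_⟩))
      exact hN j _ (hNJ j hj ▸ Nat.pos_of_ne_zero (Ne.symm h0))

variable {α : T → Type*} [∀ j, MeasurableSpace (α j)]
  (π : (j : T) → Measure (α j)) [∀ j, IsProbabilityMeasure (π j)]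

theorem lintegral_prod_infinitePi {f : (j : T) → α j → ℝ≥0∞} (hf : ∀ j, Measurable (f j))
    (s : Finset T) :
    ∫⁻ a, ∏ j ∈ s, f j (a j) ∂Measure.infinitePi π = ∏ j ∈ s, ∫⁻ b, f j b ∂π j := by
  refine (lintegral_prod_eq_prod_lintegral_of_indepFun s (fun j (a : (j : T) → α j) => f j (a j))
    (iIndepFun_infinitePi (P := π) hf) fun j => by fun_prop).trans ?_
  refine Finset.prod_congr rfl fun j _ => ?_
  exact (measurePreserving_eval_infinitePi π j).lintegral_comp (hf j)

theorem lintegral_tprod_infinitePi [Countable T] {f : (j : T) → α j → ℝ≥0∞}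
    (hf : ∀ j, Measurable (f j)) (hf1 : ∀ j b, f j b ≤ 1) :
    ∫⁻ a, ∏' j, f j (a j) ∂Measure.infinitePi π = ∏' j, ∫⁻ b, f j b ∂π j := by
  have hlim := tendsto_lintegral_filter_of_dominated_convergence (μ := Measure.infinitePi π)
    (l := atTop) (F := fun (s : Finset T) a => ∏ j ∈ s, f j (a j)) (fun _ => 1)
    (.of_forall fun s => by fun_prop)
    (.of_forall fun s => ae_of_all _ fun a => Finset.prod_le_one' fun j _ => hf1 j (a j))
    (by simp) (ae_of_all _ fun a => hasProd_of_le_one fun j => hf1 j (a j))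
  simp only [lintegral_prod_infinitePi π hf] at hlim
  have hprod' : HasProd (fun j => ∫⁻ b, f j b ∂π j) _ := hlim
  exact hprod'.tprod_eq.symm

end InfiniteProduct

section Thinning

/-- The probability that `n` points, independently retained with probability `x`, leave exactly `m`
of them, and that these independently pass a test with success probability `w`. -/
noncomputable def thinWeight (x w : I) (n m : ℕ) : ℝ≥0∞ :=
  .ofReal (n.choose m * x ^ m * (1 - x) ^ (n - m) * w ^ m)

variable (x w : I)

theorem thinWeight_toReal (n m : ℕ) :
    (thinWeight x w n m).toReal = n.choose m * x ^ m * (1 - x) ^ (n - m) * w ^ m :=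
  ENNReal.toReal_ofReal (by have := x.2.1; have := w.2.1; have := sub_nonneg.2 x.2.2; positivity)

theorem thinWeight_of_lt {n m : ℕ} (h : n < m) : thinWeight x w n m = 0 := by
  simp [thinWeight, Nat.choose_eq_zero_of_lt h]

theorem sum_thinWeight (n : ℕ) :
    ∑ m ∈ Finset.range (n + 1), thinWeight x w n m = .ofReal ((1 - x + x * w) ^ n) := by
  have hx := x.2.1
  have hw := w.2.1
  have hx1 := sub_nonneg.2 x.2.2
  simp only [thinWeight]
  rw [← ENNReal.ofReal_sum_of_nonneg fun m _ => by positivity, add_comm (1 - (x : ℝ)), add_pow]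
  congr 1
  exact Finset.sum_congr rfl fun m _ => by rw [mul_pow]; ring

theorem thinWeight_le_one (n m : ℕ) : thinWeight x w n m ≤ 1 := by
  rcases lt_or_ge n m with h | h
  · simp [thinWeight_of_lt x w h]
  · refine (Finset.single_le_sum (f := thinWeight x w n) (fun _ _ => zero_le)
      (Finset.mem_range_succ_iff.2 h)).trans ((sum_thinWeight x w n).trans_le ?_)
    refine ENNReal.ofReal_le_one.2 (pow_le_one₀ ?_ ?_)
    · exact add_nonneg (sub_nonneg.2 x.2.2) (mul_nonneg x.2.1 w.2.1)
    · linarith [mul_le_of_le_one_right x.2.1 w.2.2]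

theorem lintegral_pmf {α : Type*} [Countable α] [MeasurableSpace α] [MeasurableSingletonClass α]
    (μ : PMF α) (f : α → ℝ≥0∞) : ∫⁻ a, f a ∂μ.toMeasure = ∑' a, μ a * f a := by
  rw [lintegral_countable']
  exact tsum_congr fun a => by
    rw [μ.toMeasure_apply_singleton _ (measurableSet_singleton a), mul_comm]

theorem toReal_lintegral_thinWeight (μ : PMF ℕ) (m : ℕ) :
    (∫⁻ n, thinWeight x w n m ∂μ.toMeasure).toReal =
      SimpleBranchingProcess.binMass μ x m * w ^ m := by
  rw [lintegral_pmf, ENNReal.tsum_toReal_eq, SimpleBranchingProcess.binMass, ← tsum_mul_right]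
  · exact tsum_congr fun n => by rw [ENNReal.toReal_mul, thinWeight_toReal, ← mul_assoc]
  · exact fun n => ENNReal.mul_ne_top (μ.apply_ne_top n) ENNReal.ofReal_ne_top

end Thinning

/-! ### The field of the fundamental system -/

namespace SimpleBranchingProcess

variable {T : Type*}

instance : DiscreteMeasurableSpace (List T) := ⟨fun _ => trivial⟩

/-- The probability that nodes with types listed in `l` are all vacant, if a node of type `j` is
occupied with probability `z j`, independently of the others. -/
noncomputable def allVacant (z : T → I) (l : List T) : I := (l.map fun j => σ (z j)).prod

theorem continuous_allVacant (l : List T) : Continuous fun z => allVacant z l :=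
  continuous_list_prod l fun j _ => unitInterval.continuous_symm.comp (continuous_apply j)

theorem antitone_allVacant (l : List T) : Antitone fun z => allVacant z l := fun _ _ hz =>
  List.prod_le_prod' (M := I) fun j _ => unitInterval.symm_le_symm.2 (hz j)

theorem ofReal_allVacant (z : T → I) (l : List T) :
    ENNReal.ofReal (allVacant z l) = (l.map fun j => .ofReal (σ (z j))).prod := by
  induction l with
  | nil => simp [allVacant]
  | cons j l ih =>
    rw [List.map_cons, List.prod_cons, ← ih, ← ENNReal.ofReal_mul (σ (z j)).2.1]
    rfl

theorem exists_one_sub_div_eq {x z : I} (hz : z ≤ x) :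
    ∃ w : I, 1 - (z : ℝ) / x = w ∧ 1 - (x : ℝ) + x * w = σ z := by
  refine ⟨⟨1 - z / x, sub_nonneg.2 (div_le_one_of_le₀ hz x.2.1),
    sub_le_self _ (div_nonneg z.2.1 x.2.1)⟩, rfl, ?_⟩
  rcases eq_or_ne x 0 with rfl | hx
  · simp [le_antisymm hz z.2.1]
  · have : (x : ℝ) ≠ 0 := Subtype.coe_ne_coe.2 hx
    rw [unitInterval.coe_symm_eq]
    field_simp
    ring

theorem tsum_tprod_thinWeight_count [DecidableEq T] (x : I) (w : T → I) (s : Multiset T) :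
    ∑' ℓ : T → ℕ, ∏' j, thinWeight x (w j) (s.count j) (ℓ j) =
      (s.map fun j => .ofReal (1 - x + x * w j)).prod := by
  rw [tsum_pi_tprod_eq_prod_sum s.toFinset (s.count ·)
    (g := fun j => thinWeight x (w j) (s.count j)), Finset.prod_multiset_map_count]
  · refine Finset.prod_congr rfl fun j _ => ?_
    rw [sum_thinWeight, ENNReal.ofReal_pow]
    exact add_nonneg (sub_nonneg.2 x.2.2) (mul_nonneg x.2.1 (w j).2.1)
  · intro j hj
    rw [Multiset.mem_toFinset, ← Multiset.count_eq_zero] at hj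
    simp [hj, thinWeight]
  · exact fun j m => thinWeight_of_lt x (w j)
  · exact fun j hj => Multiset.count_eq_zero.2 (by simpa using hj)

variable [Countable T] (B : SimpleBranchingProcess T) (k : T)

/-- The mean field of the system: the probability that a node of type `k` has no occupied child,
if each child of type `j` is occupied with probability `z j`, independently of the others. -/
noncomputable def vacancyField : C(T → I, T → I) where
  toFun z k := ⟨∫ l, (allVacant z l : ℝ) ∂(B.childrenLaw k).toMeasure, by
    simpa only [probReal_univ] using
      integral_coe_mem_Icc (B.childrenLaw k).toMeasure (allVacant z)⟩
  continuous_toFun := by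
    refine continuous_pi fun k => Continuous.subtype_mk
      (continuous_of_dominated (bound := fun _ => 1) (fun z => ?_) (fun z => ?_) ?_ ?_) _
    · exact Measurable.of_discrete.aestronglyMeasurable
    · refine ae_of_all _ fun l => ?_
      rw [Real.norm_of_nonneg (allVacant z l).2.1]
      exact (allVacant z l).2.2
    · exact integrable_const _
    · exact ae_of_all _ fun l => continuous_subtype_val.comp (continuous_allVacant l)

theorem antitone_vacancyField : Antitone B.vacancyField := fun _ _ hz _ =>
  integral_mono (integrable_coe_unitInterval .of_discrete)
    (integrable_coe_unitInterval .of_discrete) fun l => antitone_allVacant l hz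

open Classical in
theorem tsum_childrenLaw_mul (f : Multiset T → ℝ≥0∞) :
    ∑' l : List T, B.childrenLaw k l * f l = ∑' s, B.childMultisetLaw k s * f s := by
  have h (s : Multiset T) (l : List T) :
      PMF.uniformOfFinset s.lists.toFinset (lists_nonempty s) l * f l =
        PMF.uniformOfFinset s.lists.toFinset (lists_nonempty s) l * f s := by
    by_cases hl : l ∈ s.lists.toFinset
    · rw [Multiset.mem_toFinset, Multiset.mem_lists_iff] at hl
      rw [hl, Multiset.quot_mk_to_coe]
    · rw [PMF.uniformOfFinset_apply_of_notMem _ hl, zero_mul, zero_mul]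
  simp_rw [childrenLaw, PMF.bind_apply, ← ENNReal.tsum_mul_right]
  rw [ENNReal.tsum_comm]
  refine tsum_congr fun s => ?_
  simp_rw [mul_assoc, h]
  rw [ENNReal.tsum_mul_left, ENNReal.tsum_mul_right, PMF.tsum_coe, one_mul]

open Classical in
theorem lintegral_offspringLaw (f : (T → ℕ) → ℝ≥0∞) :
    ∫⁻ ξ, f ξ ∂B.offspringLaw k = ∑' s, B.childMultisetLaw k s * f fun j => s.count j := by
  have : Countable (Multiset T) := inferInstanceAs (Countable (Quotient _))
  let counts (s : Multiset T) : T → ℕ := fun j => s.count j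
  have counts_injective : Function.Injective counts := fun s t h => Multiset.ext.2 (congrFun h)
  have hcounts : ∀ᵐ ξ ∂B.offspringLaw k, ξ ∈ ⋃ s, {counts s} := by
    filter_upwards [B.finite_offspring k] with ξ hξ
    exact mem_iUnion.2 ⟨Finsupp.toMultiset (.ofSupportFinite ξ hξ),
      funext fun j => (Finsupp.count_toMultiset (.ofSupportFinite ξ hξ) j).symm⟩
  rw [← Measure.restrict_eq_self_of_ae_mem hcounts, lintegral_iUnion
    (fun s => measurableSet_singleton _)
    fun s t hst => disjoint_singleton.2 (counts_injective.ne hst)]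
  exact tsum_congr fun s => by rw [lintegral_singleton, mul_comm]; rfl

theorem tsum_tprod_lintegral_thinWeight (x : I) (w : T → I) :
    ∑' ℓ : T → ℕ, ∏' j, ∫⁻ n, thinWeight x (w j) n (ℓ j) ∂(B.offspring k j).toMeasure =
      ∫⁻ l, (l.map fun j => .ofReal (1 - x + x * w j)).prod ∂(B.childrenLaw k).toMeasure := by
  classical
  calc
    _ = ∑' ℓ : T → ℕ, ∫⁻ ξ, ∏' j, thinWeight x (w j) (ξ j) (ℓ j) ∂B.offspringLaw k :=
      tsum_congr fun ℓ => (lintegral_tprod_infinitePi _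
        (f := fun j n => thinWeight x (w j) n (ℓ j)) (fun j => .of_discrete)
        fun j n => thinWeight_le_one x (w j) n (ℓ j)).symm
    _ = ∑' s, B.childMultisetLaw k s * ∑' ℓ : T → ℕ, ∏' j,
        thinWeight x (w j) (s.count j) (ℓ j) := by
      simp_rw [lintegral_offspringLaw, ← ENNReal.tsum_mul_left]
      exact ENNReal.tsum_comm
    _ = ∑' s, B.childMultisetLaw k s * (s.map fun j => .ofReal (1 - x + x * w j)).prod := by
      simp_rw [tsum_tprod_thinWeight_count]
    _ = ∑' l, B.childrenLaw k l * (l.map fun j => .ofReal (1 - x + x * w j)).prod := by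
      simp [← tsum_childrenLaw_mul]
    _ = _ := (lintegral_pmf _ _).symm

theorem fundamentalField_eq_vacancyField {x : I} {z : T → I} (hz : ∀ j, z j ≤ x) :
    B.fundamentalField k x (fun j => z j) = B.vacancyField z k := by
  choose w hw hxw using fun j => exists_one_sub_div_eq (hz j)
  have hle (ℓ : T → ℕ) (j : T) :
      ∫⁻ n, thinWeight x (w j) n (ℓ j) ∂(B.offspring k j).toMeasure ≤ 1 :=
    (lintegral_mono fun n => thinWeight_le_one x (w j) n (ℓ j)).trans (by simp)
  calc
    _ = (∑' ℓ : T → ℕ, ∏' j,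
        ∫⁻ n, thinWeight x (w j) n (ℓ j) ∂(B.offspring k j).toMeasure).toReal := by
      simp only [toReal_tsum_tprod_of_le_one hle, toReal_lintegral_thinWeight, ← hw,
        fundamentalField]
    _ = (∫⁻ l, .ofReal (allVacant z l) ∂(B.childrenLaw k).toMeasure).toReal := by
      simp only [tsum_tprod_lintegral_thinWeight, hxw, ofReal_allVacant]
    _ = _ := (integral_eq_lintegral_of_nonneg_ae (ae_of_all _ fun l => (allVacant z l).2.1)
        Measurable.of_discrete.aestronglyMeasurable).symm

variable {B}

theorem isFundamentalSolution_of_isFixedPt_picard {z : C(I, T → I)}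
    (hz : Function.IsFixedPt (picard B.vacancyField) z) :
    B.IsFundamentalSolution fun k t => z (projIcc 0 1 zero_le_one t) k := by
  refine fun k => ⟨?_, fun x hx => ?_⟩
  · simp [(isFixedPt_picard_iff.1 hz k).1]
  · simp only [projIcc_of_mem zero_le_one hx]
    rw [B.fundamentalField_eq_vacancyField k (x := ⟨x, hx⟩) fun j =>
      hz.eq ▸ picard_apply_le ⟨x, hx⟩ j]
    exact (isFixedPt_picard_iff.1 hz k).2 ⟨x, hx⟩

theorem IsFundamentalSolution.exists_isFixedPt_picard {y : T → ℝ → ℝ}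
    (hy : B.IsFundamentalSolution y)
    (hbounds : ∀ k, ∀ x ∈ Icc (0 : ℝ) 1, 0 ≤ y k x ∧ y k x ≤ x) :
    ∃ z : C(I, T → I), Function.IsFixedPt (picard B.vacancyField) z ∧
      ∀ (x : I) k, (z x k : ℝ) = y k x := by
  have hcont (k : T) : Continuous fun x : I => y k x :=
    ContinuousOn.domRestrict fun x hx => ((hy k).2 x hx).continuousWithinAt
  let z : C(I, T → I) := ⟨fun x k => ⟨y k x, (hbounds k x x.2).1, (hbounds k x x.2).2.trans x.2.2⟩,
    continuous_pi fun k => (hcont k).subtype_mk _⟩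
  refine ⟨z, isFixedPt_picard_iff.2 fun k => ⟨Subtype.ext (hy k).1, fun x => ?_⟩, fun _ _ => rfl⟩
  rw [← B.fundamentalField_eq_vacancyField k fun j => (hbounds j x x.2).2]
  refine ((hy k).2 x x.2).congr_of_mem (fun t ht => ?_) x.2
  simp [z, projIcc_of_mem zero_le_one ht]

end SimpleBranchingProcess

/-! ### Independence of the root and the subtrees -/

theorem measurePreserving_zip_infinitePi {ι α β : Type*} [MeasurableSpace α] [MeasurableSpace β]
    (μ : Measure α) (ν : Measure β) [IsProbabilityMeasure μ] [IsProbabilityMeasure ν] :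
    MeasurePreserving (fun (p : (ι → α) × (ι → β)) i => (p.1 i, p.2 i))
      ((Measure.infinitePi fun _ => μ).prod (Measure.infinitePi fun _ => ν))
      (Measure.infinitePi fun _ => μ.prod ν) := by
  refine ⟨by fun_prop, IsProjectiveLimit.unique (fun s => ?_)
    (Measure.isProjectiveLimit_infinitePi _)⟩
  have hs : MeasurePreserving (Prod.map s.restrict s.restrict)
      ((Measure.infinitePi fun _ : ι => μ).prod (Measure.infinitePi fun _ : ι => ν))
      ((Measure.pi fun _ : s => μ).prod (Measure.pi fun _ : s => ν)) :=
    .prod ⟨by fun_prop, Measure.infinitePi_map_restrict _⟩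
      ⟨by fun_prop, Measure.infinitePi_map_restrict _⟩
  rw [Measure.map_map (by fun_prop) (by fun_prop)]
  exact ((measurePreserving_arrowProdEquivProdArrow α β s _ _).symm.comp hs).map_eq

section Subtree

variable {M : Type*}

/-- The marks in the subtree rooted at `v`, for marks `e` on the infinitary tree `List ℕ`. -/
def subtree (v : List ℕ) (e : List ℕ → M) : List ℕ → M := fun w => e (w ++ v)

theorem subtree_singleton_subtree (i : ℕ) (v : List ℕ) (e : List ℕ → M) :
    subtree [i] (subtree v e) = subtree (i :: v) e :=
  funext fun w => congrArg e (List.append_assoc w [i] v)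

variable [MeasurableSpace M] (ν : Measure M) [IsProbabilityMeasure ν]

theorem measurable_subtree (v : List ℕ) : Measurable (subtree v : (List ℕ → M) → List ℕ → M) :=
  measurable_pi_lambda _ fun _ => measurable_pi_apply _

theorem measurePreserving_subtrees :
    MeasurePreserving (fun (e : List ℕ → M) i => subtree [i] e) (Measure.infinitePi fun _ => ν)
      (Measure.infinitePi fun _ : ℕ => Measure.infinitePi fun _ => ν) := by
  have hinj : Function.Injective fun p : ℕ × List ℕ => p.2 ++ [p.1] := by
    rintro ⟨i, v⟩ ⟨j, w⟩ h
    simpa [and_comm] using h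
  refine ⟨measurable_pi_lambda _ fun i => measurable_subtree [i], ?_⟩
  rw [← Measure.infinitePi_map_curry,
    ← Measure.map_infinitePi_infinitePi_of_inj (P := fun _ : List ℕ => ν) hinj,
    Measure.map_map (by fun_prop) (by fun_prop)]
  rfl

theorem indepFun_root_subtrees :
    IndepFun (fun e : List ℕ → M => e []) (fun e i => subtree [i] e)
      (Measure.infinitePi fun _ => ν) := by
  have hind : iIndepFun (fun v (e : List ℕ → M) => e v) (Measure.infinitePi fun _ => ν) :=
    iIndepFun_infinitePi fun _ => measurable_id
  refine indep_of_indep_of_le_right (indep_of_indep_of_le_left (indep_iSup_of_disjoint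
    (fun v => (measurable_pi_apply v).comap_le) hind (S := {[]}) (T := {[]}ᶜ)
    disjoint_compl_right) ?_) ?_
  · exact le_iSup₂_of_le [] rfl le_rfl
  · refine Measurable.comap_le (@measurable_pi_lambda _ _ _ (_) _ _ fun i =>
      @measurable_pi_lambda _ _ _ (_) _ _ fun v => ?_)
    exact (comap_measurable _).mono (le_iSup₂_of_le (v ++ [i]) (by simp) le_rfl) le_rfl

theorem measurePreserving_root_subtrees :
    MeasurePreserving (fun e : List ℕ → M => (e [], fun i => subtree [i] e))
      (Measure.infinitePi fun _ => ν)
      (ν.prod (Measure.infinitePi fun _ : ℕ => Measure.infinitePi fun _ => ν)) := by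
  have hsub := measurePreserving_subtrees ν
  refine ⟨(measurable_pi_apply []).prodMk hsub.measurable, ?_⟩
  rw [(indepFun_iff_map_prod_eq_prod_map_map (measurable_pi_apply _).aemeasurable
    hsub.aemeasurable).1 (indepFun_root_subtrees ν), hsub.map_eq, Measure.infinitePi_map_eval]

end Subtree

theorem infinitePi_forall_getElem?_notMem {α T : Type*} [MeasurableSpace α] (μ : Measure α)
    [IsProbabilityMeasure μ] {A : T → Set α} (hA : ∀ j, MeasurableSet (A j)) (l : List T) :
    (Measure.infinitePi fun _ : ℕ => μ) {f | ∀ i j, l[i]? = some j → f i ∉ A j} =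
      (l.map fun j => μ (A j)ᶜ).prod := by
  have hpi : {f : ℕ → α | ∀ i j, l[i]? = some j → f i ∉ A j} =
      (Finset.range l.length : Set ℕ).pi fun i => {a | ∀ j, l[i]? = some j → a ∉ A j} := by
    ext f
    refine ⟨fun h i _ => h i, fun h i j hij => h i ?_ j hij⟩
    exact Finset.mem_coe.2 (Finset.mem_range.2 (List.getElem?_eq_some_iff.1 hij).1)
  have hbox (i : ℕ) (hi : i < l.length) : {a | ∀ j, l[i]? = some j → a ∉ A j} = (A l[i])ᶜ := by
    ext a
    simp [hi]
  rw [hpi, Measure.infinitePi_pi, Finset.prod_range, ← Fin.prod_univ_fun_getElem]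
  · exact Finset.prod_congr rfl fun i _ => by rw [hbox i i.2]
  · intro i hi
    rw [hbox i (Finset.mem_range.1 hi)]
    exact (hA _).compl

/-! ### Occupation of the root in the tree explored up to a bounded depth -/

theorem measurable_list_prod_map {α T M : Type*} [MeasurableSpace α] [MeasurableSpace M] [Monoid M]
    [MeasurableMul₂ M] {f : T → α → M} (hf : ∀ j, Measurable (f j)) (l : List T) :
    Measurable fun a => (l.map fun j => f j a).prod := by
  induction l with
  | nil => exact measurable_const
  | cons j l ih => exact (hf j).mul ih

namespace SimpleBranchingProcess

/-- The environment: for each potential node, the lists of the types of its children (one for each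
type the node may have) and its label. -/
abbrev Env (T : Type*) := List ℕ → (T → List T) × I

/-- The root, supposed to be of type `k`, becomes occupied before time `x`, as seen from the nodes
at depth less than `n` only (the deeper ones count as vacant). -/
def OccupiedBefore {T : Type*} : ℕ → T → I → Env T → Prop
  | 0, _, _, _ => False
  | n + 1, k, x, e => (e []).2 < x ∧
      ∀ i j, ((e []).1 k)[i]? = some j → ¬ OccupiedBefore n j (e []).2 (subtree [i] e)

theorem OccupiedBefore.label_lt {T : Type*} {n : ℕ} {k : T} {x : I} {e : Env T}
    (h : OccupiedBefore n k x e) : (e []).2 < x := by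
  cases n with
  | zero => exact h.elim
  | succ n => exact h.1

namespace Sample

variable {T : Type*} {ω : Sample T}

/-- The environment given by a sample, in which only the type of the root is left out. -/
def env (ω : Sample T) : Env T := fun v => (fun k => ω.children (v, k), ω.label v)

theorem tree_adj_iff {u v : ω.vertices} :
    ω.tree.Adj u v ↔
      (∃ i : ℕ, (v : List ℕ) = i :: (u : List ℕ)) ∨ ∃ i : ℕ, (u : List ℕ) = i :: (v : List ℕ) := by
  refine (SimpleGraph.fromRel_adj _ _ _).trans (and_iff_right_of_imp ?_)
  rintro (⟨i, hi⟩ | ⟨i, hi⟩) rfl <;> exact List.cons_ne_self _ _ hi.symm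

theorem nodeType_cons {v : List ℕ} {k : T} (hk : ω.nodeType v = some k) (i : ℕ) :
    ω.nodeType (i :: v) = (ω.children (v, k))[i]? := by
  simp [nodeType, hk]

theorem label_lt_of_mem_past {u : ω.vertices} (hu : u ∈ ω.tree.past ω.treeLabel ω.root) {i : ℕ}
    {v : List ℕ} (huv : (u : List ℕ) = i :: v) : ω.label u < ω.label v := by
  have hpath : Relation.ReflTransGen
    (fun a b => ω.tree.Adj a b ∧ ω.treeLabel b < ω.treeLabel a) ω.root u := hu
  induction hpath generalizing i v with
  | refl => exact absurd huv.symm (List.cons_ne_nil i v)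
  | @tail a b ha hab ih =>
    rcases tree_adj_iff.1 hab.1 with ⟨j, hj⟩ | ⟨j, hj⟩
    · rw [← (List.cons.inj (hj.symm.trans huv)).2]
      exact hab.2
    · exact absurd hab.2 (ih ha hj).not_gt

theorem exists_eq_cons_of_adj_of_lt {u v : ω.vertices} (hv : v ∈ ω.tree.past ω.treeLabel ω.root)
    (hadj : ω.tree.Adj v u) (hlt : ω.treeLabel u < ω.treeLabel v) :
    ∃ i : ℕ, (u : List ℕ) = i :: (v : List ℕ) :=
  (tree_adj_iff.1 hadj).resolve_right fun ⟨_, hi⟩ => (label_lt_of_mem_past hv hi).not_gt hlt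

theorem exists_child_mem_past {v : ω.vertices} (hv : v ∈ ω.tree.past ω.treeLabel ω.root) {i : ℕ}
    (hi : (ω.nodeType (i :: (v : List ℕ))).isSome) (hlt : ω.label (i :: (v : List ℕ)) < ω.label v) :
    ∃ u ∈ ω.tree.past ω.treeLabel ω.root, (u : List ℕ) = i :: (v : List ℕ) ∧ ω.tree.Adj v u :=
  have hadj : ω.tree.Adj v ⟨i :: (v : List ℕ), hi⟩ := tree_adj_iff.2 (.inl ⟨i, rfl⟩)
  ⟨⟨i :: (v : List ℕ), hi⟩, .tail hv ⟨hadj, hlt⟩, rfl, hadj⟩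

theorem mem_greedyMIS_iff_occupiedBefore [Finite (ω.tree.past ω.treeLabel ω.root)] {N : ℕ}
    (hN : ∀ u ∈ ω.tree.past ω.treeLabel ω.root, (u : List ℕ).length ≤ N) {n : ℕ}
    (v : ω.tree.past ω.treeLabel ω.root) (hn : N < n + (v : List ℕ).length) {k : T}
    (hk : ω.nodeType v = some k) {x : I} (hx : ω.label v < x) :
    v ∈ (ω.tree.induce (ω.tree.past ω.treeLabel ω.root)).greedyMIS (fun u => ω.treeLabel u) ↔
      OccupiedBefore n k x (subtree v ω.env) := by
  induction n generalizing v k x with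
  | zero => exact absurd (hN _ v.2) (by lia)
  | succ n ih =>
    have ih_child {u : ω.tree.past ω.treeLabel ω.root} {i : ℕ} {j : T} (hu : (u : List ℕ) = i :: v)
        (hj : (ω.children (v, k))[i]? = some j) (hlt : ω.label (i :: v) < ω.label v) :
        u ∈ (ω.tree.induce (ω.tree.past ω.treeLabel ω.root)).greedyMIS (fun u => ω.treeLabel u) ↔
          OccupiedBefore n j (ω.label v) (subtree [i] (subtree v ω.env)) := by
      rw [subtree_singleton_subtree, ← hu]
      exact ih u (by simp only [hu, List.length_cons]; lia) (by rw [hu, nodeType_cons hk, hj])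
        (by rwa [hu])
    rw [SimpleGraph.mem_greedyMIS]
    refine ⟨fun h => ⟨hx, fun i j hj hocc => ?_⟩, fun h u hlt hadj hmem => ?_⟩
    · have hlt : ω.label (i :: v) < ω.label v := hocc.label_lt
      have hnode : (ω.nodeType (i :: v)).isSome :=
        Option.isSome_iff_exists.2 ⟨j, (nodeType_cons hk i).trans hj⟩
      obtain ⟨u, hu, huv, hadj⟩ := exists_child_mem_past v.2 hnode hlt
      refine h ⟨u, hu⟩ ?_ hadj ((ih_child huv hj hlt).2 hocc)
      simpa only [treeLabel, huv] using hlt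
    · obtain ⟨i, hi : (u : List ℕ) = i :: v⟩ := exists_eq_cons_of_adj_of_lt v.2 hadj hlt
      obtain ⟨j, hj⟩ := Option.isSome_iff_exists.1 u.1.2
      rw [hi, nodeType_cons hk] at hj
      refine h.2 i j hj ((ih_child hi hj ?_).1 hmem)
      simpa only [treeLabel, hi] using hlt

theorem eventually_occupiedBefore_iff (hfin : (ω.tree.past ω.treeLabel ω.root).Finite)
    (hroot : ω.label [] < 1) :
    ∀ᶠ n in atTop, OccupiedBefore n ω.rootType 1 ω.env ↔
      ω.tree.GreedyOccupied ω.treeLabel ω.root := by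
  have : Finite (ω.tree.past ω.treeLabel ω.root) := hfin.to_subtype
  obtain ⟨N, hN⟩ := (hfin.image fun u : ω.vertices => (u : List ℕ).length).bddAbove
  filter_upwards [eventually_gt_atTop N] with n hn
  have hmem := mem_greedyMIS_iff_occupiedBefore (fun u hu => hN ⟨u, hu, rfl⟩)
    ⟨ω.root, ω.tree.self_mem_past _ _⟩ (n := n) (by lia) (k := ω.rootType) rfl hroot
  have hnil : subtree [] ω.env = ω.env := funext fun w => congrArg ω.env w.append_nil
  rw [← hnil]
  exact ⟨fun h => ⟨hfin, hmem.2 h⟩, fun ⟨_, h⟩ => hmem.1 h⟩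

end Sample

variable {T : Type*}

theorem measurable_getElem?_eq_some (k : T) (i : ℕ) (j : T) :
    Measurable fun c : T → List T => (c k)[i]? = some j :=
  (Measurable.of_discrete (f := fun l : List T => l[i]? = some j)).comp (measurable_pi_apply k)

variable [Countable T] (B : SimpleBranchingProcess T)

theorem measurable_forall_children {A : T → I → Env T → Prop}
    (hA : ∀ j, Measurable fun p : I × Env T => A j p.1 p.2) (k : T) :
    Measurable fun q : I × ((T → List T) × I) × (ℕ → Env T) =>
      q.2.1.2 < q.1 ∧ ∀ i j, (q.2.1.1 k)[i]? = some j → ¬ A j q.2.1.2 (q.2.2 i) := by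
  refine (measurableSet_setOfPred.1 (measurableSet_lt (by fun_prop) (by fun_prop))).and <|
    .forall fun i => .forall fun j => .imp ?_ (Measurable.not ?_)
  · exact (measurable_getElem?_eq_some k i j).comp (by fun_prop)
  · exact (hA j).comp (f := fun q : I × ((T → List T) × I) × (ℕ → Env T) => (q.2.1.2, q.2.2 i))
      (by fun_prop)

theorem measurable_occupiedBefore (n : ℕ) (k : T) :
    Measurable fun p : I × Env T => OccupiedBefore n k p.1 p.2 := by
  induction n generalizing k with
  | zero => exact measurable_const
  | succ n ih =>
    have hsub : Measurable fun (e : Env T) i => subtree [i] e :=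
      measurable_pi_lambda _ fun i => measurable_subtree [i]
    exact (measurable_forall_children ih k).comp
      (f := fun p : I × Env T => (p.1, p.2 [], fun i => subtree [i] p.2)) <|
      measurable_fst.prodMk <|
        ((measurable_pi_apply _).comp measurable_snd).prodMk (hsub.comp measurable_snd)

theorem measurableSet_occupiedBefore (n : ℕ) (k : T) (x : I) :
    MeasurableSet {e | OccupiedBefore n k x e} :=
  ((measurable_occupiedBefore n k).comp measurable_prodMk_left).setOf

/-- The law of the marks of a node. -/
noncomputable def markLaw : Measure ((T → List T) × I) :=
  (Measure.infinitePi fun k => (B.childrenLaw k).toMeasure).prod volume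

instance : IsProbabilityMeasure B.markLaw := by
  unfold markLaw
  infer_instance

/-- The law of the environment. -/
noncomputable def envLaw : Measure (Env T) := Measure.infinitePi fun _ => B.markLaw

instance : IsProbabilityMeasure B.envLaw := by
  unfold envLaw
  infer_instance

theorem lintegral_markLaw (k : T) {f : I → List T → ℝ≥0∞} (hf : ∀ l, Measurable fun s => f s l) :
    ∫⁻ m, f m.2 (m.1 k) ∂B.markLaw = ∫⁻ s, ∫⁻ l, f s l ∂(B.childrenLaw k).toMeasure := by
  have hf' : Measurable f.uncurry := measurable_from_prod_countable_left hf
  rw [markLaw, lintegral_prod_symm' _ (by fun_prop)]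
  refine lintegral_congr fun s => ?_
  exact (measurePreserving_eval_infinitePi (fun k => (B.childrenLaw k).toMeasure) k).lintegral_comp
    (f := f s) .of_discrete

theorem measurable_envLaw_compl_occupiedBefore (n : ℕ) (j : T) :
    Measurable fun s => B.envLaw {e | OccupiedBefore n j s e}ᶜ :=
  measurable_measure_prodMk_left (measurable_occupiedBefore n j).setOf.compl

theorem envLaw_occupiedBefore_succ (n : ℕ) (k : T) (x : I) :
    B.envLaw {e | OccupiedBefore (n + 1) k x e} = ∫⁻ s in Iio x,
      ∫⁻ l, (l.map fun j => B.envLaw {e | OccupiedBefore n j s e}ᶜ).prod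
        ∂(B.childrenLaw k).toMeasure := by
  let vacant (s : I) (l : List T) : ℝ≥0∞ :=
    (l.map fun j => B.envLaw {e | OccupiedBefore n j s e}ᶜ).prod
  let S : Set (((T → List T) × I) × (ℕ → Env T)) := {q | q.1.2 < x ∧
    ∀ i j, (q.1.1 k)[i]? = some j → q.2 i ∉ {e | OccupiedBefore n j q.1.2 e}}
  have hS : MeasurableSet S :=
    ((measurable_forall_children (measurable_occupiedBefore n) k).comp measurable_prodMk_left).setOf
  have hfibre (m : (T → List T) × I) : (Measure.infinitePi fun _ : ℕ => B.envLaw)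
      (Prod.mk m ⁻¹' S) = (Iio x).indicator (fun s => vacant s (m.1 k)) m.2 := by
    rcases lt_or_ge m.2 x with hx | hx
    · rw [indicator_of_mem (mem_Iio.2 hx)]
      refine Eq.trans ?_ (infinitePi_forall_getElem?_notMem B.envLaw
        (fun j => measurableSet_occupiedBefore n j m.2) (m.1 k))
      simp [S, hx]
    · simp [S, hx.not_gt]
  calc
    _ = (B.markLaw.prod (Measure.infinitePi fun _ : ℕ => B.envLaw)) S :=
      (measurePreserving_root_subtrees B.markLaw).measure_preimage hS.nullMeasurableSet
    _ = ∫⁻ m, (Iio x).indicator (fun s => vacant s (m.1 k)) m.2 ∂B.markLaw := by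
      rw [Measure.prod_apply hS]
      exact lintegral_congr hfibre
    _ = ∫⁻ s, ∫⁻ l, (Iio x).indicator (fun s => vacant s l) s ∂(B.childrenLaw k).toMeasure :=
      B.lintegral_markLaw k (f := fun s l => (Iio x).indicator (fun s => vacant s l) s) fun l =>
        (measurable_list_prod_map (B.measurable_envLaw_compl_occupiedBefore n) l).indicator
          measurableSet_Iio
    _ = ∫⁻ s in Iio x, ∫⁻ l, vacant s l ∂(B.childrenLaw k).toMeasure := by
      rw [← lintegral_indicator measurableSet_Iio]
      refine lintegral_congr fun s => ?_
      by_cases hs : s ∈ Iio x <;> simp [hs]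

theorem envLaw_occupiedBefore (n : ℕ) (k : T) (x : I) :
    B.envLaw {e | OccupiedBefore n k x e} =
      .ofReal ((picard B.vacancyField)^[n] 0 x k) := by
  induction n generalizing k x with
  | zero => simp [OccupiedBefore]
  | succ n ih =>
    set y := (picard B.vacancyField)^[n] 0
    have hvac (s : I) (l : List T) : (l.map fun j => B.envLaw {e | OccupiedBefore n j s e}ᶜ).prod =
        .ofReal (allVacant (y s) l) := by
      simp_rw [ofReal_allVacant, prob_compl_eq_one_sub (measurableSet_occupiedBefore n _ s), ih,
        unitInterval.coe_symm_eq, ENNReal.ofReal_sub _ (y s _).2.1, ENNReal.ofReal_one]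
    have hfield (s : I) : ∫⁻ l, .ofReal (allVacant (y s) l) ∂(B.childrenLaw k).toMeasure =
        .ofReal (B.vacancyField (y s) k) :=
      (ofReal_integral_eq_lintegral_ofReal (integrable_coe_unitInterval .of_discrete)
        (ae_of_all _ fun l => (allVacant (y s) l).2.1)).symm
    simp_rw [envLaw_occupiedBefore_succ, hvac, hfield, Function.iterate_succ_apply', coe_picard]
    refine (ofReal_integral_eq_lintegral_ofReal (integrable_coe_unitInterval ?_)
      (ae_of_all _ fun s => (B.vacancyField (y s) k).2.1)).symm
    fun_prop

end SimpleBranchingProcess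

/-! ### Convergence to the law of the greedy independent set -/

theorem tendsto_measureReal_of_ae_eventually_mem_iff {α : Type*} [MeasurableSpace α] {μ : Measure α}
    [IsFiniteMeasure μ] {A : ℕ → Set α} {S : Set α} (hA : ∀ n, MeasurableSet (A n))
    (h : ∀ᵐ a ∂μ, ∀ᶠ n in atTop, a ∈ A n ↔ a ∈ S) :
    Tendsto (fun n => μ.real (A n)) atTop (𝓝 (μ.real S)) := by
  have hS : NullMeasurableSet S μ :=
    nullMeasurableSet_of_tendsto_indicator atTop (fun n => (hA n).nullMeasurableSet) h
  refine (ENNReal.tendsto_toReal (measure_ne_top μ S)).comp ?_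
  rw [← measure_congr hS.toMeasurable_ae_eq]
  refine tendsto_measure_of_ae_tendsto_indicator_of_isFiniteMeasure atTop
    (measurableSet_toMeasurable μ S) hA ?_
  filter_upwards [h, hS.toMeasurable_ae_eq.mem_iff] with a ha hSa
  simpa only [hSa] using ha

theorem hasSum_mul_toReal_pmf {α : Type*} [MeasurableSpace α] [DiscreteMeasurableSpace α]
    (p : PMF α) (f : α → I) :
    HasSum (fun a => (f a : ℝ) * (p a).toReal) (∫ a, (f a : ℝ) ∂p.toMeasure) := by
  have hsum : Summable fun a => (f a : ℝ) * (p a).toReal :=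
    .of_nonneg_of_le (fun a => mul_nonneg (f a).2.1 ENNReal.toReal_nonneg)
      (fun a => mul_le_of_le_one_left ENNReal.toReal_nonneg (f a).2.2)
      (ENNReal.summable_toReal p.tsum_coe_ne_top)
  rw [p.integral_eq_tsum _ (integrable_coe_unitInterval .of_discrete)]
  simpa only [smul_eq_mul, mul_comm] using hsum.hasSum

namespace SimpleBranchingProcess

variable {T : Type*} [Countable T] (B : SimpleBranchingProcess T)

theorem measurePreserving_env : MeasurePreserving
    (fun (p : (List ℕ × T → List T) × (List ℕ → I)) v => (fun k => p.1 (v, k), p.2 v))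
    ((Measure.infinitePi fun vk : List ℕ × T => (B.childrenLaw vk.2).toMeasure).prod
      (Measure.infinitePi fun _ => volume)) B.envLaw := by
  have hcurry : MeasurePreserving (MeasurableEquiv.curry (List ℕ) T (List T))
      (Measure.infinitePi fun vk : List ℕ × T => (B.childrenLaw vk.2).toMeasure)
      (Measure.infinitePi fun _ => Measure.infinitePi fun k => (B.childrenLaw k).toMeasure) :=
    ⟨MeasurableEquiv.measurable _,
      Measure.infinitePi_map_curry fun _ k => (B.childrenLaw k).toMeasure⟩
  exact (measurePreserving_zip_infinitePi _ _).comp (hcurry.prod (.id _))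

variable [MeasurableSpace T]

theorem measurePreserving_rootType_env :
    MeasurePreserving (fun ω : Sample T => (ω.rootType, ω.env)) B.law
      (B.root.toMeasure.prod B.envLaw) := by
  have hprod := (MeasurePreserving.id B.root.toMeasure).prod B.measurePreserving_env
  have hofProd : Measurable (Sample.ofProd (T := T)) := fun _ hs => hs
  have hmeas : Measurable fun ω : Sample T => (ω.rootType, ω.env) := fun _ hs =>
    hprod.measurable hs
  refine ⟨hmeas, ?_⟩
  rw [law, Measure.map_map hmeas hofProd]
  exact hprod.map_eq

instance : IsProbabilityMeasure B.law :=
  (Measure.isProbabilityMeasure_map_iff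
    B.measurePreserving_rootType_env.aemeasurable).1 <| by
      rw [B.measurePreserving_rootType_env.map_eq]
      infer_instance

theorem ae_label_root_lt_one : ∀ᵐ ω ∂B.law, ω.label [] < 1 := by
  have hlabel : MeasurePreserving (fun ω : Sample T => ω.label []) B.law volume :=
    measurePreserving_snd.comp <|
      (measurePreserving_eval_infinitePi (fun _ => B.markLaw) []).comp <|
        measurePreserving_snd.comp B.measurePreserving_rootType_env
  filter_upwards [hlabel.quasiMeasurePreserving.ae (Measure.ae_ne volume 1)] with ω hω
  exact lt_of_le_of_ne unitInterval.le_one' hω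

variable [DiscreteMeasurableSpace T]

theorem measurableSet_rootType_occupiedBefore (n : ℕ) (x : I) :
    MeasurableSet {q : T × Env T | OccupiedBefore n q.1 x q.2} :=
  (measurable_from_prod_countable_right fun k =>
    (measurable_occupiedBefore n k).comp measurable_prodMk_left).setOf

theorem law_real_occupiedBefore (n : ℕ) (x : I) :
    B.law.real {ω | OccupiedBefore n ω.rootType x ω.env} =
      ∫ k, ((picard B.vacancyField)^[n] 0 x k : ℝ) ∂B.root.toMeasure := by
  have hmeas := measurableSet_rootType_occupiedBefore (T := T) n x
  rw [integral_eq_lintegral_of_nonneg_ae (ae_of_all _ fun k => (_ : I).2.1) .of_discrete]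
  refine congrArg ENNReal.toReal ?_
  calc
    _ = (B.root.toMeasure.prod B.envLaw) {q | OccupiedBefore n q.1 x q.2} :=
      B.measurePreserving_rootType_env.measure_preimage hmeas.nullMeasurableSet
    _ = ∫⁻ k, B.envLaw {e | OccupiedBefore n k x e} ∂B.root.toMeasure := Measure.prod_apply hmeas
    _ = _ := by simp_rw [envLaw_occupiedBefore]

variable {B}

theorem tendsto_law_occupiedBefore (hB : B.NonexplosiveGrowth) :
    Tendsto (fun n => B.law.real {ω | OccupiedBefore n ω.rootType 1 ω.env}) atTop (𝓝 B.iota) := by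
  refine tendsto_measureReal_of_ae_eventually_mem_iff (fun n =>
    B.measurePreserving_rootType_env.measurable (measurableSet_rootType_occupiedBefore n 1)) ?_
  filter_upwards [hB, B.ae_label_root_lt_one] with ω hfin hroot
  exact Sample.eventually_occupiedBefore_iff hfin hroot

theorem hasSum_isFixedPt_picard (hB : B.NonexplosiveGrowth) {y : C(I, T → I)}
    (hy : Function.IsFixedPt (picard B.vacancyField) y) :
    HasSum (fun k => (y 1 k : ℝ) * (B.root k).toReal) B.iota := by
  have hlim := tendsto_law_occupiedBefore hB
  simp only [law_real_occupiedBefore] at hlim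
  have hmono {u v : C(I, T → I)} (huv : u ≤ v) :
      ∫ k, (u 1 k : ℝ) ∂B.root.toMeasure ≤ ∫ k, (v 1 k : ℝ) ∂B.root.toMeasure :=
    integral_mono (integrable_coe_unitInterval .of_discrete)
      (integrable_coe_unitInterval .of_discrete) fun k => huv 1 k
  have hbounds := iterate_picard_bounds B.antitone_vacancyField hy
  have heven : Tendsto (fun n => 2 * n) atTop atTop :=
    tendsto_id.const_mul_atTop' two_pos
  have hodd : Tendsto (fun n => 2 * n + 1) atTop atTop :=
    (tendsto_add_atTop_nat 1).comp heven
  rw [← le_antisymm (ge_of_tendsto' (hlim.comp hodd) fun n => hmono (hbounds n).2)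
    (le_of_tendsto' (hlim.comp heven) fun n => hmono (hbounds n).1)]
  exact hasSum_mul_toReal_pmf B.root (y 1)

end SimpleBranchingProcess

theorem theorem1p3 {T : Type*} [Countable T] [MeasurableSpace T] [DiscreteMeasurableSpace T]
    (B : SimpleBranchingProcess T) (hB : B.NonexplosiveGrowth) :
    (∃ y : T → ℝ → ℝ, B.IsFundamentalSolution y ∧
      (∀ k, ∀ x ∈ Set.Icc (0 : ℝ) 1, 0 ≤ y k x ∧ y k x ≤ x) ∧
      HasSum (fun k => y k 1 * (B.root k).toReal) B.iota) ∧
    (∀ y : T → ℝ → ℝ, B.IsFundamentalSolution y →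
      (∀ k, ∀ x ∈ Set.Icc (0 : ℝ) 1, 0 ≤ y k x ∧ y k x ≤ x) →
      HasSum (fun k => y k 1 * (B.root k).toReal) B.iota) := by
  have formula {y : T → ℝ → ℝ} (hy : B.IsFundamentalSolution y)
      (hbounds : ∀ k, ∀ x ∈ Icc (0 : ℝ) 1, 0 ≤ y k x ∧ y k x ≤ x) :
      HasSum (fun k => y k 1 * (B.root k).toReal) B.iota := by
    obtain ⟨z, hz, hzy⟩ := hy.exists_isFixedPt_picard hbounds
    simpa only [hzy, Icc.coe_one] using
      SimpleBranchingProcess.hasSum_isFixedPt_picard hB hz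
  refine ⟨?_, fun y => formula⟩
  obtain ⟨z, hz⟩ := exists_isFixedPt_picard B.vacancyField
  have hsol := SimpleBranchingProcess.isFundamentalSolution_of_isFixedPt_picard hz
  have hbounds (k : T) (x : ℝ) (hx : x ∈ Icc (0 : ℝ) 1) :
      0 ≤ (z (projIcc 0 1 zero_le_one x) k : ℝ) ∧ (z (projIcc 0 1 zero_le_one x) k : ℝ) ≤ x := by
    rw [projIcc_of_mem zero_le_one hx]
    exact ⟨(z ⟨x, hx⟩ k).2.1, hz.eq ▸ picard_apply_le ⟨x, hx⟩ k⟩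
  exact ⟨_, hsol, hbounds, formula hsol hbounds⟩
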